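/- Let $n, N \ge 0$ be integers, and write $[n]=\{1,\dots,n\}$ (the particle labels) and $[N]=\{1,\dots,N\}$ (the sites). For $\mathbf x \in [N]^n$ and $i\in[N]$ let $n_i(\mathbf x)=|\{a\in[n] : x_a=i\}|$, and let $$\Lambda^n=\{\mathbf x\in[N]^n : n_i(\mathbf x)\text{ is even for all } i\in[N]\}$$ be the even configuration space (it is empty when $n$ is odd; the case of interest is $n$ even). For labels $a\ne b$ and sites $i, j$, let $m_{ab}^{ij}\mathbf x$ be the configuration obtained from $\mathbf x$ by moving the particles $a$ and $b$ to site $j$ if $x_a=x_b=i$, and $m_{ab}^{ij}\mathbf x=\mathbf x$ otherwise; let $s_{ab}^{ij}\mathbf x$ be obtained from $\mathbf x$ by moving $a$ to $j$ and $b$ to $i$ if $x_a=i$ and $x_b=j$, and $s_{ab}^{ij}\mathbf x=\mathbf x$ otherwise. Both maps send $\Lambda^n$ to itself. For $f:\Lambda^n\to\mathbb R$ and $i<j$ in $[N]$, define the two-site generator $\mathcal L_{ij}=\mathcal M_{ij}-\mathcal E_{ij}$ by $$\mathcal M_{ij}f(\mathbf x)=\frac{n_j(\mathbf x)+1}{n_i(\mathbf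 x)-1}\sum_{a\ne b\in[n]}\bigl(f(m_{ab}^{ij}\mathbf x)-f(\mathbf x)\bigr)+\frac{n_i(\mathbf x)+1}{n_j(\mathbf x)-1}\sum_{a\ne b\in[n]}\bigl(f(m_{ab}^{ji}\mathbf x)-f(\mathbf x)\bigr),$$ $$\mathcal E_{ij}f(\mathbf x)=2\sum_{a\ne b\in[n]}\bigl(f(s_{ab}^{ij}\mathbf x)-f(\mathbf x)\bigr),$$ where the sums run over ordered pairs of distinct labels. Let $M_n$ be the set of perfect matchings of $[n]$, that is, of fixed-point-free involutions $\sigma$ of $[n]$; put $\sigma\cdot\mathbf x=(x_{\sigma(1)},\dots,x_{\sigma(n)})$, and for $\sigma\in M_n$ define the stratum indicator $\chi_\sigma:\Lambda^n\to\mathbb R$ by $$\chi_\sigma(\mathbf x)=\frac{\mathbf 1\{\sigma\cdot\mathbf x=\mathbf x\}}{\sum_{\sigma'\in M_n}\mathbf 1\{\sigma'\cdot\mathbf x=\mathbf x\}}.$$ **Corollary.** The common kernel of all two-site generators is exactly the span of the stratum indicators: $$\bigcap_{1\le i<j\le N}\ker(\mathcal L_{ij})=\operatorname{span}_{\mathbb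 R}\{\chi_\sigma : \sigma\in M_n\}.$$ Moreover, if $n\le 2N$, then the functions $\chi_\sigma$, $\sigma\in M_n$, are linearly independent, so that this kernel has dimension $n!!$, where $k!!=(k-1)\,(k-2)!!$, $0!!=1$ and $1!!=0$. -/

import Mathlib

namespace ColoredFlow

/-- The number of particles that the configuration `x` puts at the site `i`. Particles are labelled
by `Fin n` and sites by `Fin N`. -/
def particleNumber {n N : ℕ} (i : Fin N) (x : Fin n → Fin N) : ℕ :=
  (Finset.univ.filter fun a => x a = i).card

/-- A configuration is even if every site is occupied by an even number of particles. -/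
def IsEven {n N : ℕ} (x : Fin n → Fin N) : Prop :=
  ∀ i, Even (particleNumber i x)

/-- The even configuration space. -/
abbrev EvenConfig (n N : ℕ) : Type :=
  {x : Fin n → Fin N // IsEven x}

/-- Ordered pairs of distinct labels. -/
abbrev LabelPair (n : ℕ) : Type :=
  {p : Fin n × Fin n // p.1 ≠ p.2}

/-- The two particle jump on all configurations: the particles `a` and `b` move from `i` to `j` if
both of them are at `i`; otherwise nothing happens. -/
def rawJump {n N : ℕ} (i j : Fin N) (a b : Fin n) (x : Fin n → Fin N) : Fin n → Fin N :=
  fun c => if (c = a ∨ c = b) ∧ x a = i ∧ x b = i then j else x c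

/-- The two particle swap on all configurations: if `a` is at `i` and `b` is at `j`, then `a` moves
to `j` and `b` moves to `i`; otherwise nothing happens. -/
def rawSwap {n N : ℕ} (i j : Fin N) (a b : Fin n) (x : Fin n → Fin N) : Fin n → Fin N :=
  fun c => if c = a ∧ x a = i ∧ x b = j then j
    else if c = b ∧ x a = i ∧ x b = j then i
    else x c

theorem isEven_comp_perm {n N : ℕ} {x : Fin n → Fin N} (hx : IsEven x)
    (σ : Equiv.Perm (Fin n)) : IsEven (fun a => x (σ a)) := by
  intro k
  have h : particleNumber k (fun a => x (σ a)) = particleNumber k x := by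
    unfold particleNumber
    exact Finset.card_equiv σ (by intro a; simp)
  rw [h]
  exact hx k

theorem isEven_rawJump {n N : ℕ} (i j : Fin N) {a b : Fin n} (hab : a ≠ b)
    {x : Fin n → Fin N} (hx : IsEven x) : IsEven (rawJump i j a b x) := by
  by_cases h : x a = i ∧ x b = i
  · obtain ⟨ha, hb⟩ := h
    intro k
    have key : ∀ y : Fin n → Fin N, particleNumber k y =
        (if y a = k then 1 else 0) + ((if y b = k then 1 else 0) +
          ∑ c ∈ (Finset.univ.erase a).erase b, if y c = k then 1 else 0) := by
      intro y
      unfold particleNumber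
      rw [Finset.card_filter, ← Finset.add_sum_erase _ _ (Finset.mem_univ a),
        ← Finset.add_sum_erase (Finset.univ.erase a) _
          (Finset.mem_erase.mpr ⟨hab.symm, Finset.mem_univ b⟩)]
    have hrest : (∑ c ∈ (Finset.univ.erase a).erase b,
          if rawJump i j a b x c = k then 1 else 0) =
        ∑ c ∈ (Finset.univ.erase a).erase b, if x c = k then 1 else 0 := by
      refine Finset.sum_congr rfl fun c hc => ?_
      simp only [Finset.mem_erase, Finset.mem_univ, and_true] at hc
      simp [rawJump, hc.1, hc.2]
    have h1 := hx k
    rw [key x, ha, hb] at h1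
    rw [key, hrest]
    simp only [rawJump, ha, hb]
    revert h1
    generalize (∑ c ∈ (Finset.univ.erase a).erase b, if x c = k then 1 else 0) = m
    grind
  · have : rawJump i j a b x = x := by
      funext c
      simp [rawJump, h]
    rw [this]
    exact hx

theorem isEven_rawSwap {n N : ℕ} (i j : Fin N) (a b : Fin n)
    {x : Fin n → Fin N} (hx : IsEven x) : IsEven (rawSwap i j a b x) := by
  by_cases h : x a = i ∧ x b = j
  · have : rawSwap i j a b x = fun c => x (Equiv.swap a b c) := by
      funext c
      obtain ⟨ha, hb⟩ := h
      by_cases hca : c = a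
      · subst hca
        simp [rawSwap, ha, hb]
      · by_cases hcb : c = b
        · subst hcb
          simp [rawSwap, ha, hb, hca]
        · simp [rawSwap, hca, hcb, Equiv.swap_apply_of_ne_of_ne hca hcb]
    rw [this]
    exact isEven_comp_perm hx _
  · have : rawSwap i j a b x = x := by
      funext c
      simp [rawSwap, h]
    rw [this]
    exact hx

/-- The two particle jump operator on even configurations. -/
def jump {n N : ℕ} (i j : Fin N) (p : LabelPair n) (x : EvenConfig n N) : EvenConfig n N :=
  ⟨rawJump i j p.1.1 p.1.2 x.1, isEven_rawJump i j p.2 x.2⟩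

/-- The two particle swap operator on even configurations. -/
def swap {n N : ℕ} (i j : Fin N) (p : LabelPair n) (x : EvenConfig n N) : EvenConfig n N :=
  ⟨rawSwap i j p.1.1 p.1.2 x.1, isEven_rawSwap i j p.1.1 p.1.2 x.2⟩

/-- The move operator between the sites `i` and `j`. The denominators are odd integers because the
particle numbers are even. -/
noncomputable def moveOp {n N : ℕ} (i j : Fin N) (f : EvenConfig n N → ℝ) :
    EvenConfig n N → ℝ := fun x =>
  ((particleNumber j x.1 : ℝ) + 1) / ((particleNumber i x.1 : ℝ) - 1) *
      ∑ p : LabelPair n, (f (jump i j p x) - f x) +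
    ((particleNumber i x.1 : ℝ) + 1) / ((particleNumber j x.1 : ℝ) - 1) *
      ∑ p : LabelPair n, (f (jump j i p x) - f x)

/-- The exchange operator between the sites `i` and `j`. -/
noncomputable def exchangeOp {n N : ℕ} (i j : Fin N) (f : EvenConfig n N → ℝ) :
    EvenConfig n N → ℝ := fun x =>
  2 * ∑ p : LabelPair n, (f (swap i j p x) - f x)

/-- The two-site generator: the move operator minus the exchange operator. -/
noncomputable def twoSiteGenerator {n N : ℕ} (i j : Fin N) :
    (EvenConfig n N → ℝ) →ₗ[ℝ] (EvenConfig n N → ℝ) where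
  toFun f := moveOp i j f - exchangeOp i j f
  map_add' f g := by
    funext x
    simp only [moveOp, exchangeOp, Pi.sub_apply, Pi.add_apply, add_sub_add_comm,
      Finset.sum_add_distrib]
    ring
  map_smul' r f := by
    funext x
    simp only [moveOp, exchangeOp, Pi.sub_apply, Pi.smul_apply, smul_eq_mul, RingHom.id_apply,
      ← mul_sub, ← Finset.mul_sum]
    ring

/-- The common kernel of all two-site generators. -/
noncomputable def globalKernel (n N : ℕ) : Submodule ℝ (EvenConfig n N → ℝ) :=
  ⨅ (i : Fin N) (j : Fin N) (_ : i < j), LinearMap.ker (twoSiteGenerator i j)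

/-- Perfect matchings of the label set: fixed point free involutions. -/
abbrev PerfectMatching (n : ℕ) : Type :=
  {σ : Equiv.Perm (Fin n) // ∀ a, σ (σ a) = a ∧ σ a ≠ a}

/-- The action of a permutation of the labels on even configurations. -/
def relabel {n N : ℕ} (σ : Equiv.Perm (Fin n)) (x : EvenConfig n N) : EvenConfig n N :=
  ⟨fun a => x.1 (σ a), isEven_comp_perm x.2 σ⟩

/-- The stratum indicator of a perfect matching `σ`: the indicator that `σ` stabilizes `x`, divided
by the number of perfect matchings that stabilize `x`. -/
noncomputable def stratumIndicator {n N : ℕ} (σ : PerfectMatching n) : EvenConfig n N → ℝ :=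
  fun x => (if relabel σ.1 x = x then 1 else 0) /
    ∑ τ : PerfectMatching n, (if relabel τ.1 x = x then 1 else 0)

/-- The double factorial with the convention `k!! = (k - 1) (k - 2)!!`, `0!! = 1`, `1!! = 0`. -/
def matchingFactorial : ℕ → ℕ
  | 0 => 1
  | 1 => 0
  | k + 2 => (k + 1) * matchingFactorial k

end ColoredFlow

/-! Let `m x` be the number of perfect matchings stabilizing `x`. It is positive on even
configurations, so `f ↦ f * m`, extended by zero, embeds functions on even configurations into
tensors of rank `n` over `ℝ^N`. It sends the stratum indicator of `σ` to the Brauer tensor of `σ`,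
and conjugates the two-site generator into `R²`, where `R` is the infinitesimal rotation in the
plane of the two sites (`matchingCount_mul_twoSiteGenerator`). The rates of the move operator are
exactly the ratios of values of `m` along a jump (`matchingCount_rawJump`).

Since `R` is antisymmetric, `R²` and `R` have the same kernel. The common kernel thus becomes the
space of even tensors annihilated by all rotations; evenness is invariance under coordinate
reflections, so these are the `O(N)`-invariant tensors. By the first fundamental theorem they are
spanned by the Brauer tensors (`mem_span_matchingTensor`).

That theorem is proved by induction on the rank. If an invariant even tensor is orthogonal to every
Brauer tensor, then so are its pair traces, which therefore vanish; and a traceless invariant even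
tensor of positive rank is zero (`eq_zero_of_traceless`), by a positivity argument.

For independence, when `n ≤ 2 * N` the pairs of `σ` fit on distinct sites, giving a configuration
that only `σ` stabilizes. -/

namespace ColoredFlow

/-! ### Infinitesimal rotations, Brauer tensors and traceless invariants -/

section Tensor

set_option linter.unusedSectionVars false

variable {ι S : Type*} [Fintype ι] [DecidableEq ι] [DecidableEq S]

/-- The number of labels that a configuration puts at a site. -/
def occupation (i : S) (x : ι → S) : ℕ :=
  (Finset.univ.filter fun a => x a = i).card

/-- The infinitesimal rotation in the plane of the sites `i` and `j`, acting on tensors. -/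
def rotation (i j : S) (g : (ι → S) → ℝ) (x : ι → S) : ℝ :=
  ∑ a, ((if x a = i then g (Function.update x a j) else 0) -
    (if x a = j then g (Function.update x a i) else 0))

/-- Invariance under all infinitesimal rotations. -/
def IsInvariant (g : (ι → S) → ℝ) : Prop :=
  ∀ i j x, rotation i j g x = 0

/-- A tensor is even if it is supported on even configurations. -/
def IsEvenTensor (g : (ι → S) → ℝ) : Prop :=
  ∀ i x, ¬ Even (occupation i x) → g x = 0

/-- The Brauer tensor of a permutation: the indicator that the permutation stabilizes `x`. -/
def matchingTensor (σ : Equiv.Perm ι) (x : ι → S) : ℝ :=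
  if (fun a => x (σ a)) = x then 1 else 0

/-- A fixed point free involution. -/
def IsMatching (σ : Equiv.Perm ι) : Prop := ∀ a, σ (σ a) = a ∧ σ a ≠ a

theorem sum_update_adjoint [Fintype S] (i j : S) (a : ι) (g h : (ι → S) → ℝ) :
    ∑ x, (if x a = i then g (Function.update x a j) else 0) * h x =
      ∑ x, g x * (if x a = j then h (Function.update x a i) else 0) := by
  simp only [ite_mul, zero_mul, mul_ite, mul_zero]
  rw [← Finset.sum_filter, ← Finset.sum_filter]
  refine Finset.sum_nbij' (fun x => Function.update x a j) (fun x => Function.update x a i)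
    ?_ ?_ ?_ ?_ ?_
  · simp
  · simp
  · intro x hx
    simp only [Finset.mem_filter, Finset.mem_univ, true_and] at hx
    simp [← hx]
  · intro x hx
    simp only [Finset.mem_filter, Finset.mem_univ, true_and] at hx
    simp [← hx]
  · intro x hx
    simp only [Finset.mem_filter, Finset.mem_univ, true_and] at hx
    simp [← hx]

/-- Moving a label from `i` to `j` is adjoint to moving it back, so exchanging the two terms of the
rotation changes its sign. -/
theorem rotation_adjoint [Fintype S] (i j : S) (g h : (ι → S) → ℝ) :
    ∑ x, rotation i j g x * h x = - ∑ x, g x * rotation i j h x := by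
  simp only [rotation, Finset.sum_mul, Finset.mul_sum, sub_mul, mul_sub]
  rw [Finset.sum_comm]
  conv_rhs => rw [Finset.sum_comm, ← Finset.sum_neg_distrib]
  refine Finset.sum_congr rfl fun a _ => ?_
  rw [Finset.sum_sub_distrib, Finset.sum_sub_distrib, sum_update_adjoint, sum_update_adjoint]
  ring

/-- Antisymmetry gives `‖R g‖² = -⟨g, R² g⟩`. The hypothesis only concerns the product, so nothing
need be known about `R² g` where `g` vanishes. -/
theorem rotation_eq_zero_of_sq [Fintype S] (i j : S) (g : (ι → S) → ℝ)
    (h : ∀ x, g x * rotation i j (rotation i j g) x = 0) (x : ι → S) : rotation i j g x = 0 := by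
  have h1 := rotation_adjoint i j g (rotation i j g)
  rw [Finset.sum_eq_zero fun x _ => h x, neg_zero,
    Finset.sum_eq_zero_iff_of_nonneg fun _ _ => mul_self_nonneg _] at h1
  simpa using h1 x (Finset.mem_univ x)

/-- The term moving `a` from `i` to `j` is nonzero only if the partner `σ a` is already at `j`; it
then cancels the term moving `σ a` from `j` to `i`. -/
theorem rotation_matchingTensor {σ : Equiv.Perm ι} (hσ : IsMatching σ) (i j : S) (x : ι → S) :
    rotation i j (matchingTensor σ) x = 0 := by
  unfold rotation
  rw [Finset.sum_sub_distrib, sub_eq_zero]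
  refine Fintype.sum_equiv σ _ _ fun a => ?_
  have key : ∀ (a : ι) (k : S), (fun b => Function.update x a k (σ b)) = Function.update x a k ↔
      x (σ a) = k ∧ ∀ b, b ≠ a → b ≠ σ a → x (σ b) = x b := by
    intro a k
    rw [funext_iff]
    constructor
    · intro h
      constructor
      · have := h a
        simpa [Function.update_of_ne (hσ a).2] using this
      · intro b hb hb'
        have := h b
        have h2 : σ b ≠ a := fun h => hb' (by rw [← h, (hσ b).1])
        simpa [Function.update_of_ne h2, Function.update_of_ne hb] using this
    · rintro ⟨h1, h2⟩ b
      by_cases hb : b = a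
      · subst hb
        simp [Function.update_of_ne (hσ b).2, h1]
      · by_cases hb' : b = σ a
        · subst hb'
          simp [(hσ a).1, Function.update_of_ne (hσ a).2, h1]
        · have h3 : σ b ≠ a := fun h => hb' (by rw [← h, (hσ b).1])
          rw [Function.update_of_ne h3, Function.update_of_ne hb, h2 b hb hb']
  unfold matchingTensor
  rw [← ite_and, ← ite_and]
  congr 1
  rw [key, key, (hσ a).1]
  apply propext
  constructor
  · rintro ⟨h1, h2, h3⟩
    exact ⟨h2, h1, fun b hb hb' => h3 b hb' hb⟩
  · rintro ⟨h1, h2, h3⟩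
    exact ⟨h2, h1, fun b hb hb' => h3 b hb' hb⟩

theorem isEvenTensor_matchingTensor {σ : Equiv.Perm ι} (hσ : IsMatching σ) :
    IsEvenTensor (matchingTensor σ : (ι → S) → ℝ) := by
  intro i x hx
  unfold matchingTensor
  rw [if_neg]
  intro h
  apply hx
  -- If `σ` stabilizes `x`, it acts on each fibre without fixed points, so the fibre has even size.
  have h2 : ∑ a ∈ Finset.univ.filter (fun a => x a = i), (1 : ZMod 2) = 0 := by
    refine Finset.sum_involution (fun a _ => σ a) ?_ ?_ ?_ ?_
    · intros; decide
    · intro a _ _; exact (hσ a).2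
    · intro a ha
      simp only [Finset.mem_filter, Finset.mem_univ, true_and] at ha ⊢
      rw [← ha]; exact congrFun h a
    · intro a _; exact (hσ a).1
  simp only [Finset.sum_const, nsmul_eq_mul, mul_one] at h2
  exact (ZMod.natCast_eq_zero_iff_even).1 h2

/-- Replacing the entries at `a` and `b` by `k`. -/
def setPair (a b : ι) (x : ι → S) (k : S) : ι → S :=
  Function.update (Function.update x a k) b k

theorem setPair_apply (a b : ι) (x : ι → S) (k : S) (c : ι) :
    setPair a b x k c = if c = a ∨ c = b then k else x c := by
  unfold setPair
  by_cases h1 : c = b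
  · subst h1; simp
  · by_cases h2 : c = a
    · subst h2; simp [Function.update_of_ne h1]
    · simp [h1, h2]

theorem setPair_setPair (a b : ι) (x : ι → S) (k l : S) :
    setPair a b (setPair a b x k) l = setPair a b x l := by
  funext c
  simp only [setPair_apply]
  split_ifs <;> rfl

theorem setPair_self {a b : ι} {x : ι → S} (h : x a = x b) : setPair a b x (x a) = x := by
  funext c
  simp only [setPair_apply]
  split_ifs with hc
  · rcases hc with rfl | rfl
    · rfl
    · exact h
  · rfl

/-- Partial traces over all sites except `s` are nonnegative in the mean. -/
theorem sum_mul_partialTrace_nonneg [Fintype S] (s : S) (a b : ι) (g : (ι → S) → ℝ) :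
    0 ≤ ∑ z ∈ Finset.univ.filter (fun z : ι → S => (∀ c, z c ≠ s) ∧ z a = z b),
      g z * ∑ k ∈ Finset.univ.erase s, g (setPair a b z k) := by
  set B := Finset.univ.filter (fun z : ι → S => (∀ c, z c ≠ s) ∧ z a = z b) with hB
  set T := (Finset.univ.erase s : Finset S) with hT
  set t : (ι → S) → ℝ := fun z => ∑ k ∈ T, g (setPair a b z k) with ht
  have htk : ∀ z k, t (setPair a b z k) = t z := fun z k => by
    simp only [ht, setPair_setPair]
  -- Exchanging the common value at `a`, `b` with the trace variable `k` is an involution of `B ×ˢ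
  -- T` that preserves `t`. It yields `|T| * ∑ g t = ∑ t²`.
  have hmem : ∀ p ∈ B ×ˢ T, (setPair a b p.1 p.2, p.1 a) ∈ B ×ˢ T := by
    rintro ⟨z, k⟩ hp
    simp only [hB, hT, Finset.mem_product, Finset.mem_filter, Finset.mem_univ, true_and,
      Finset.mem_erase, and_true] at hp ⊢
    refine ⟨⟨fun c => ?_, ?_⟩, hp.1.1 a⟩
    · rw [setPair_apply]; split_ifs
      · exact hp.2
      · exact hp.1.1 c
    · simp [setPair_apply]
  have hinv : ∀ p ∈ B ×ˢ T, (setPair a b (setPair a b p.1 p.2) (p.1 a), setPair a b p.1 p.2 a) = p := by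
    rintro ⟨z, k⟩ hp
    simp only [hB, hT, Finset.mem_product, Finset.mem_filter, Finset.mem_univ, true_and] at hp
    rw [setPair_setPair, setPair_self hp.1.2]
    simp [setPair_apply]
  have h1 : ∑ p ∈ B ×ˢ T, g p.1 * t p.1 = ∑ p ∈ B ×ˢ T, g (setPair a b p.1 p.2) * t p.1 := by
    refine Finset.sum_nbij' (fun p => (setPair a b p.1 p.2, p.1 a))
      (fun p => (setPair a b p.1 p.2, p.1 a)) hmem hmem hinv hinv ?_
    rintro ⟨z, k⟩ hp
    simp only [hB, hT, Finset.mem_product, Finset.mem_filter, Finset.mem_univ, true_and] at hp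
    simp only [setPair_setPair, setPair_self hp.1.2, htk]
  rw [Finset.sum_product, Finset.sum_product] at h1
  simp only [Finset.sum_const, nsmul_eq_mul, ← Finset.sum_mul, ← Finset.mul_sum] at h1
  have h2 : 0 ≤ (T.card : ℝ) * ∑ z ∈ B, g z * t z := by
    rw [h1]
    exact Finset.sum_nonneg fun z _ => mul_self_nonneg (t z)
  by_cases hc : T.card = 0
  · have hTe : T = ∅ := Finset.card_eq_zero.1 hc
    simp [hTe]
  · exact nonneg_of_mul_nonneg_right h2 (by positivity)

/-- An invariant even tensor of positive rank with vanishing pair traces is zero. -/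
theorem eq_zero_of_traceless [Fintype S] [Nonempty ι] {g : (ι → S) → ℝ} (hinv : IsInvariant g)
    (heven : IsEvenTensor g) (htr : ∀ a b, a ≠ b → ∀ x, ∑ k, g (setPair a b x k) = 0) :
    ∀ x, g x = 0 := by
  intro x₀
  obtain ⟨a₀⟩ := ‹Nonempty ι›
  -- Any site would serve; positive rank guarantees that one exists.
  set s := x₀ a₀
  have htr' : ∀ a b, a ≠ b → ∀ x, g (setPair a b x s) =
      - ∑ k ∈ Finset.univ.erase s, g (setPair a b x k) := by
    intro a b hab x
    have := htr a b hab x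
    rw [← Finset.add_sum_erase _ _ (Finset.mem_univ s)] at this
    linarith
  -- Invariance is applied to `z` with `a₀` moved to `s`: the term of `a₀` restores `z`, and the
  -- others put a pair at `s`, which tracelessness spreads over the remaining sites.
  have hkey : ∀ z : ι → S, (∀ c, z c ≠ s) → g z = - ∑ a ∈ Finset.univ.erase a₀,
      if z a₀ = z a then ∑ k ∈ Finset.univ.erase s, g (setPair a₀ a z k) else 0 := by
    intro z hz
    have h := hinv (z a₀) s (Function.update z a₀ s)
    unfold rotation at h
    rw [← Finset.add_sum_erase _ _ (Finset.mem_univ a₀)] at h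
    have h2 : ∀ a ∈ Finset.univ.erase a₀,
        ((if Function.update z a₀ s a = z a₀ then
            g (Function.update (Function.update z a₀ s) a s) else 0) -
          (if Function.update z a₀ s a = s then
            g (Function.update (Function.update z a₀ s) a (z a₀)) else 0)) =
        - if z a₀ = z a then ∑ k ∈ Finset.univ.erase s, g (setPair a₀ a z k) else 0 := by
      intro a ha
      have ha' : a ≠ a₀ := Finset.ne_of_mem_erase ha
      rw [Function.update_of_ne ha', if_neg (hz a), sub_zero]
      by_cases hc : z a₀ = z a
      · rw [if_pos hc, if_pos hc.symm]
        exact htr' a₀ a ha'.symm z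
      · rw [if_neg hc, if_neg (Ne.symm hc), neg_zero]
    rw [Finset.sum_congr rfl h2, Finset.sum_neg_distrib] at h
    simp only [Function.update_self, Function.update_idem, Function.update_eq_self, if_true,
      if_neg (hz a₀).symm] at h
    linarith
  -- Multiplying `hkey` by `g z` and summing equates a sum of squares with minus a sum of
  -- nonnegative terms.
  have hB : ∀ z : ι → S, (∀ c, z c ≠ s) → g z = 0 := by
    have hsum : ∑ z ∈ Finset.univ.filter (fun z : ι → S => ∀ c, z c ≠ s), g z * g z =
        - ∑ a ∈ Finset.univ.erase a₀,
          ∑ z ∈ Finset.univ.filter (fun z : ι → S => (∀ c, z c ≠ s) ∧ z a₀ = z a),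
            g z * ∑ k ∈ Finset.univ.erase s, g (setPair a₀ a z k) := by
      simp only [← Finset.filter_filter, Finset.sum_filter (fun z : ι → S => z a₀ = z _)]
      rw [Finset.sum_comm, ← Finset.sum_neg_distrib]
      refine Finset.sum_congr rfl fun z hz => ?_
      simp only [Finset.mem_filter, Finset.mem_univ, true_and] at hz
      refine (congrArg (g z * ·) (hkey z hz)).trans ?_
      simp only [mul_neg, Finset.mul_sum, mul_ite, mul_zero]
    have hle : ∑ z ∈ Finset.univ.filter (fun z : ι → S => ∀ c, z c ≠ s), g z * g z ≤ 0 := by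
      rw [hsum, neg_nonpos]
      exact Finset.sum_nonneg fun a _ => sum_mul_partialTrace_nonneg s a₀ a g
    have h0 := (Finset.sum_eq_zero_iff_of_nonneg fun z _ => mul_self_nonneg (g z)).1
      (le_antisymm hle (Finset.sum_nonneg fun z _ => mul_self_nonneg (g z)))
    intro z hz
    simpa using h0 z (by simpa using hz)
  -- Induction on the occupation of `s`: evenness settles odd occupations, and tracelessness moves a
  -- pair away from `s` otherwise.
  have hall : ∀ m : ℕ, ∀ x : ι → S, occupation s x = m → g x = 0 := by
    intro m
    induction m using Nat.strong_induction_on with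
    | _ m ih =>
      intro x hx
      by_cases hm : m = 0
      · apply hB
        intro c hc
        have : (Finset.univ.filter fun a => x a = s) = ∅ := by
          rw [← Finset.card_eq_zero]; exact hx.trans hm
        have hc' : c ∈ (Finset.univ.filter fun a => x a = s) := by simpa using hc
        simp [this] at hc'
      · by_cases hev : Even (occupation s x)
        · have h2 : 1 < (Finset.univ.filter fun a => x a = s).card := by
            change 1 < occupation s x
            rcases hev with ⟨r, hr⟩
            omega
          obtain ⟨a, ha, b, hb, hab⟩ := Finset.one_lt_card.1 h2
          simp only [Finset.mem_filter, Finset.mem_univ, true_and] at ha hb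
          have hxs : setPair a b x s = x := by
            have := setPair_self (ha.trans hb.symm)
            rwa [ha] at this
          rw [← hxs, htr' a b hab, neg_eq_zero]
          refine Finset.sum_eq_zero fun k hk => ?_
          have hk' : k ≠ s := Finset.ne_of_mem_erase hk
          refine ih (occupation s (setPair a b x k)) ?_ _ rfl
          rw [← hx]
          unfold occupation
          apply Finset.card_lt_card
          rw [Finset.ssubset_iff_of_subset]
          · exact ⟨a, by simpa using ha, by simp [setPair_apply, hk']⟩
          · intro c
            simp only [Finset.mem_filter, Finset.mem_univ, true_and, setPair_apply]
            split_ifs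
            · intro h; exact absurd h hk'
            · exact id
        · exact heven s x hev
  exact hall _ x₀ rfl

end Tensor

/-! ### Pair traces and their duality with adding a pair to a matching -/

section Trace

set_option linter.unusedSectionVars false

variable {ι S : Type*} [Fintype ι] [DecidableEq ι] [DecidableEq S]

/-- The labels different from `a` and `b`. -/
abbrev PairCompl (a b : ι) : Type _ := {c : ι // c ≠ a ∧ c ≠ b}

/-- Extending a configuration of the labels different from `a` and `b` by `k` at `a` and `b`. -/
def extendPair (a b : ι) (y : PairCompl a b → S) (k : S) : ι → S :=
  fun c => if h : c ≠ a ∧ c ≠ b then y ⟨c, h⟩ else k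

/-- The trace of a tensor over the labels `a` and `b`. -/
def pairTrace [Fintype S] (a b : ι) (g : (ι → S) → ℝ) (y : PairCompl a b → S) : ℝ :=
  ∑ k, g (extendPair a b y k)

theorem extendPair_left (a b : ι) (y : PairCompl a b → S) (k : S) :
    extendPair a b y k a = k := by simp [extendPair]

theorem extendPair_right (a b : ι) (y : PairCompl a b → S) (k : S) :
    extendPair a b y k b = k := by simp [extendPair]

theorem extendPair_coe (a b : ι) (y : PairCompl a b → S) (k : S) (c : PairCompl a b) :
    extendPair a b y k c = y c := by simp [extendPair, c.2]

theorem extendPair_restrict (a b : ι) (x : ι → S) (k : S) :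
    extendPair a b (fun c => x c) k = setPair a b x k := by
  funext c
  rw [setPair_apply, extendPair]
  by_cases h1 : c = a <;> by_cases h2 : c = b <;> simp [h1, h2]

theorem extendPair_update (a b : ι) (y : PairCompl a b → S) (k : S) (c : PairCompl a b) (j : S) :
    extendPair a b (Function.update y c j) k =
      Function.update (extendPair a b y k) c.1 j := by
  funext d
  by_cases hd : d = c.1
  · subst hd; simp [extendPair, c.2]
  · rw [Function.update_of_ne hd]
    unfold extendPair
    split_ifs with h
    · rw [Function.update_of_ne]
      intro h'; exact hd (congrArg Subtype.val h')
    · rfl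

theorem sum_eq_add_add_sum_pairCompl {M : Type*} [AddCommMonoid M] {a b : ι} (hab : a ≠ b)
    (F : ι → M) : ∑ c, F c = F a + (F b + ∑ c : PairCompl a b, F c) := by
  rw [← Finset.add_sum_erase _ _ (Finset.mem_univ a), ← Finset.add_sum_erase (Finset.univ.erase a) _
      (Finset.mem_erase.mpr ⟨hab.symm, Finset.mem_univ b⟩)]
  congr 2
  refine Finset.sum_subtype _ (fun c => ?_) F
  simp [and_comm]

/-- Rotating the full tensor and then tracing gives the rotation of the trace plus the terms of `a`
and `b`; these cancel because the contracted form is itself invariant. -/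
theorem isInvariant_pairTrace [Fintype S] {a b : ι} (hab : a ≠ b) {g : (ι → S) → ℝ}
    (hg : IsInvariant g) : IsInvariant (pairTrace a b g) := by
  intro i j y
  have h : ∑ k, rotation i j g (extendPair a b y k) = 0 :=
    Finset.sum_eq_zero fun k _ => hg i j _
  simp only [rotation, sum_eq_add_add_sum_pairCompl hab, extendPair_left, extendPair_right,
    extendPair_coe, Finset.sum_add_distrib, Finset.sum_sub_distrib, Finset.sum_ite_eq',
    Finset.mem_univ, if_true] at h
  have hsymm : ∀ k l : S, Function.update (extendPair a b y k) a l =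
      Function.update (extendPair a b y l) b k := by
    intro k l
    funext c
    by_cases h1 : c = a
    · subst h1; simp [Function.update_of_ne hab, extendPair]
    · by_cases h2 : c = b
      · subst h2; simp [Function.update_of_ne hab.symm, extendPair]
      · simp [h1, h2, extendPair]
  rw [hsymm i j, hsymm j i, Finset.sum_comm, Finset.sum_comm (γ := S)] at h
  unfold rotation pairTrace
  simp only [extendPair_update]
  rw [Finset.sum_sub_distrib]
  have hif : ∀ (c : PairCompl a b) (i j : S),
      (∑ k, if y c = i then g (Function.update (extendPair a b y k) c.1 j) else 0) =
      if y c = i then ∑ k, g (Function.update (extendPair a b y k) c.1 j) else 0 := by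
    intro c i j
    split_ifs <;> simp
  simp only [hif] at h
  linarith

theorem isEvenTensor_pairTrace [Fintype S] {a b : ι} (hab : a ≠ b) {g : (ι → S) → ℝ}
    (hg : IsEvenTensor g) : IsEvenTensor (pairTrace a b g) := by
  intro i y hy
  refine Finset.sum_eq_zero fun k _ => hg i _ fun h => hy ?_
  unfold occupation at h ⊢
  rw [Finset.card_filter, sum_eq_add_add_sum_pairCompl hab] at h
  simp only [extendPair_left, extendPair_right, extendPair_coe] at h
  rw [Finset.card_filter]
  grind

/-- Adding the pair `a`, `b` to a matching of the other labels. -/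
def addPair (a b : ι) (τ : Equiv.Perm (PairCompl a b)) : Equiv.Perm ι :=
  Equiv.Perm.ofSubtype τ * Equiv.swap a b

theorem addPair_left (a b : ι) (τ : Equiv.Perm (PairCompl a b)) : addPair a b τ a = b := by
  simp [addPair, Equiv.Perm.ofSubtype_apply_of_not_mem]

theorem addPair_right (a b : ι) (τ : Equiv.Perm (PairCompl a b)) : addPair a b τ b = a := by
  simp [addPair, Equiv.Perm.ofSubtype_apply_of_not_mem]

theorem addPair_coe (a b : ι) (τ : Equiv.Perm (PairCompl a b)) (c : PairCompl a b) :
    addPair a b τ c = τ c := by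
  simp [addPair, Equiv.swap_apply_of_ne_of_ne c.2.1 c.2.2]

theorem eq_or_eq_or_coe (a b c : ι) : c = a ∨ c = b ∨ ∃ d : PairCompl a b, c = d := by
  by_cases h1 : c = a
  · exact Or.inl h1
  · by_cases h2 : c = b
    · exact Or.inr (Or.inl h2)
    · exact Or.inr (Or.inr ⟨⟨c, h1, h2⟩, rfl⟩)

theorem isMatching_addPair {a b : ι} (hab : a ≠ b) {τ : Equiv.Perm (PairCompl a b)}
    (hτ : IsMatching τ) : IsMatching (addPair a b τ) := by
  intro c
  rcases eq_or_eq_or_coe a b c with rfl | rfl | ⟨d, rfl⟩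
  · simp [addPair_left, addPair_right, hab.symm]
  · simp [addPair_left, addPair_right, hab]
  · simp only [addPair_coe, (hτ d).1, true_and]
    exact fun h => (hτ d).2 (Subtype.ext h)

theorem comp_addPair_eq_iff (a b : ι) (τ : Equiv.Perm (PairCompl a b)) (x : ι → S) :
    (fun c => x (addPair a b τ c)) = x ↔
      x a = x b ∧ (fun c : PairCompl a b => x (τ c)) = fun c : PairCompl a b => x c := by
  simp only [funext_iff]
  constructor
  · intro h
    refine ⟨?_, fun c => ?_⟩
    · have := h a; rw [addPair_left] at this; exact this.symm
    · have := h c; rwa [addPair_coe] at this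
  · rintro ⟨h1, h2⟩ c
    rcases eq_or_eq_or_coe a b c with rfl | rfl | ⟨d, rfl⟩
    · rw [addPair_left, h1]
    · rw [addPair_right, h1]
    · rw [addPair_coe, h2]

/-- Adding a pair to a matching is adjoint to the pair trace, so orthogonality to Brauer tensors
passes to traces. -/
theorem sum_mul_matchingTensor_addPair [Fintype S] (a b : ι)
    (τ : Equiv.Perm (PairCompl a b)) (g : (ι → S) → ℝ) :
    ∑ x, g x * matchingTensor (addPair a b τ) x =
      ∑ y, pairTrace a b g y * matchingTensor τ y := by
  unfold pairTrace matchingTensor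
  simp only [comp_addPair_eq_iff, mul_ite, mul_one, mul_zero]
  rw [← Finset.sum_filter, ← Finset.sum_filter, ← Finset.sum_product']
  refine Finset.sum_nbij' (fun x => ((fun c : PairCompl a b => x c), x a))
    (fun p => extendPair a b p.1 p.2) ?_ ?_ ?_ ?_ ?_
  · intro x hx
    simpa using (Finset.mem_filter.1 hx).2.2
  · rintro ⟨y, k⟩ hy
    simpa [extendPair_left, extendPair_right, extendPair_coe] using hy
  · intro x hx
    simp only [Finset.mem_filter, Finset.mem_univ, true_and] at hx
    rw [extendPair_restrict, setPair_self hx.1]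
  · rintro ⟨y, k⟩ _
    simp [extendPair_left, extendPair_coe]
  · intro x hx
    simp only [Finset.mem_filter, Finset.mem_univ, true_and] at hx
    rw [extendPair_restrict, setPair_self hx.1]

end Trace

/-! ### The first fundamental theorem -/

/-- An invariant even tensor orthogonal to all Brauer tensors is zero. -/
theorem eq_zero_of_orthogonal {S : Type*} [Fintype S] [DecidableEq S] (m : ℕ) :
    ∀ {ι : Type} [Fintype ι] [DecidableEq ι], Fintype.card ι = m → ∀ {g : (ι → S) → ℝ},
      IsInvariant g → IsEvenTensor g →
      (∀ σ : Equiv.Perm ι, IsMatching σ → ∑ x, g x * matchingTensor σ x = 0) → ∀ x, g x = 0 := by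
  induction m using Nat.strong_induction_on with
  | _ m ih =>
    intro ι _ _ hcard g hinv heven horth
    rcases isEmpty_or_nonempty ι with hι | hι
    · intro x
      -- In rank zero there is one configuration, and the identity is vacuously a matching.
      have h := horth 1 fun a => (hι.false a).elim
      rw [Fintype.sum_eq_single x fun y hy => absurd (Subsingleton.elim y x) hy] at h
      simpa [matchingTensor] using h
    · refine eq_zero_of_traceless hinv heven fun a b hab x => ?_
      have hlt : Fintype.card (PairCompl a b) < m := by
        rw [← hcard]
        exact Fintype.card_subtype_lt (x := a) (by simp)
      have h := ih _ hlt rfl (isInvariant_pairTrace hab hinv) (isEvenTensor_pairTrace hab heven)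
        (fun τ hτ => by
          rw [← sum_mul_matchingTensor_addPair]
          exact horth _ (isMatching_addPair hab hτ)) (fun c => x c)
      unfold pairTrace at h
      simpa only [extendPair_restrict] using h

theorem rotation_sub {ι S : Type*} [Fintype ι] [DecidableEq ι] [DecidableEq S] (i j : S)
    (g h : (ι → S) → ℝ) (x : ι → S) :
    rotation i j (g - h) x = rotation i j g x - rotation i j h x := by
  simp only [rotation, ← Finset.sum_sub_distrib, Pi.sub_apply]
  refine Finset.sum_congr rfl fun a _ => ?_
  split_ifs <;> ring

theorem rotation_smul {ι S : Type*} [Fintype ι] [DecidableEq ι] [DecidableEq S] (i j : S)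
    (r : ℝ) (g : (ι → S) → ℝ) (x : ι → S) :
    rotation i j (r • g) x = r * rotation i j g x := by
  simp only [rotation, Finset.mul_sum, Pi.smul_apply, smul_eq_mul]
  refine Finset.sum_congr rfl fun a _ => ?_
  split_ifs <;> ring

theorem isInvariant_and_isEvenTensor_of_mem_span {ι S : Type*} [Fintype ι] [DecidableEq ι]
    [DecidableEq S] {d : (ι → S) → ℝ}
    (hd : d ∈ Submodule.span ℝ (Set.range fun σ : {σ : Equiv.Perm ι // IsMatching σ} =>
      (matchingTensor σ.1 : (ι → S) → ℝ))) : IsInvariant d ∧ IsEvenTensor d := by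
  induction hd using Submodule.span_induction with
  | mem d hd =>
    obtain ⟨σ, rfl⟩ := hd
    exact ⟨fun i j x => rotation_matchingTensor σ.2 i j x, isEvenTensor_matchingTensor σ.2⟩
  | zero => exact ⟨fun i j x => by simp [rotation], fun i x _ => rfl⟩
  | add d d' _ _ h h' =>
    refine ⟨fun i j x => ?_, fun i x hx => by simp [h.2 i x hx, h'.2 i x hx]⟩
    have h1 := h.1 i j x
    have h2 := h'.1 i j x
    have h3 := rotation_sub i j (d + d') d' x
    rw [add_sub_cancel_right] at h3
    linarith
  | smul r d _ h =>
    refine ⟨fun i j x => ?_, fun i x hx => by simp [h.2 i x hx]⟩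
    have h1 := h.1 i j x
    rw [rotation_smul, h1, mul_zero]

/-- The first fundamental theorem for the orthogonal group, multilinear form: an even tensor
annihilated by the infinitesimal rotations is a combination of Brauer tensors. -/
theorem mem_span_matchingTensor {ι : Type} {S : Type*} [Fintype ι] [DecidableEq ι] [Fintype S]
    [DecidableEq S] {g : (ι → S) → ℝ} (hinv : IsInvariant g) (heven : IsEvenTensor g) :
    g ∈ Submodule.span ℝ (Set.range fun σ : {σ : Equiv.Perm ι // IsMatching σ} =>
      (matchingTensor σ.1 : (ι → S) → ℝ)) := by
  set D := Submodule.span ℝ (Set.range fun σ : {σ : Equiv.Perm ι // IsMatching σ} =>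
      (matchingTensor σ.1 : (ι → S) → ℝ)) with hD
  -- The Euclidean structure supplies the orthogonal projection onto the span of the Brauer tensors.
  let e := WithLp.linearEquiv 2 ℝ ((ι → S) → ℝ)
  obtain ⟨y, hy, z, hz, hyz⟩ := Submodule.exists_add_mem_mem_orthogonal
    (K := D.comap e.toLinearMap) (e.symm g)
  have hgy : e z = g - e y := by
    rw [← e.apply_symm_apply g, hyz]; simp
  have hyD : e y ∈ D := hy
  have hDinv := isInvariant_and_isEvenTensor_of_mem_span hyD
  have h0 : ∀ x, e z x = 0 := by
    refine eq_zero_of_orthogonal _ rfl (fun i j x => ?_) (fun i x hx => ?_) fun σ hσ => ?_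
    · rw [hgy, rotation_sub, hinv, hDinv.1, sub_zero]
    · rw [hgy, Pi.sub_apply, heven i x hx, hDinv.2 i x hx, sub_zero]
    · have h := hz (e.symm (matchingTensor σ)) (by
        change e (e.symm _) ∈ D
        rw [e.apply_symm_apply]
        exact Submodule.subset_span ⟨⟨σ, hσ⟩, rfl⟩)
      rw [PiLp.inner_apply] at h
      have h' : ∑ x, z.ofLp x * (e.symm (matchingTensor σ)).ofLp x = 0 := by simpa using h
      exact h'
  have : g = e y := by
    have h1 : e z = 0 := funext h0
    rw [h1] at hgy
    exact sub_eq_zero.1 hgy.symm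
  rw [this]
  exact hyD

theorem rotation_swap {ι S : Type*} [Fintype ι] [DecidableEq ι] [DecidableEq S] (i j : S)
    (g : (ι → S) → ℝ) (x : ι → S) : rotation j i g x = - rotation i j g x := by
  simp only [rotation, ← Finset.sum_neg_distrib, neg_sub]

theorem rotation_self {ι S : Type*} [Fintype ι] [DecidableEq ι] [DecidableEq S] (i : S)
    (g : (ι → S) → ℝ) (x : ι → S) : rotation i i g x = 0 := by
  simp [rotation]

/-! ### The weight counting stabilizing matchings -/

/-- The number of perfect matchings that stabilize a configuration. -/
def matchingCount {n N : ℕ} (x : Fin n → Fin N) : ℝ :=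
  ∑ σ : PerfectMatching n, matchingTensor σ.1 x

variable {n N : ℕ}

theorem isInvariant_matchingCount : IsInvariant (matchingCount : (Fin n → Fin N) → ℝ) := by
  refine (isInvariant_and_isEvenTensor_of_mem_span ?_).1
  have : (matchingCount : (Fin n → Fin N) → ℝ) =
      ∑ σ : PerfectMatching n, matchingTensor σ.1 := by
    funext x; simp [matchingCount]
  rw [this]
  exact Submodule.sum_mem _ fun σ _ => Submodule.subset_span ⟨⟨σ.1, σ.2⟩, rfl⟩

theorem matchingTensor_nonneg (σ : Equiv.Perm (Fin n)) (x : Fin n → Fin N) :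
    0 ≤ matchingTensor σ x := by
  unfold matchingTensor
  split_ifs <;> norm_num

/-- Conjugation by `τ` is a bijection between the matchings stabilizing the two configurations. -/
theorem matchingCount_comp (τ : Equiv.Perm (Fin n)) (x : Fin n → Fin N) :
    matchingCount (fun a => x (τ a)) = matchingCount x := by
  unfold matchingCount
  refine Fintype.sum_equiv (Equiv.subtypeEquiv τ.permCongr fun σ => ?_) _ _ fun σ => ?_
  · conv_rhs => rw [← τ.forall_congr_right]
    simp
  · unfold matchingTensor
    congr 1
    simp only [funext_iff, eq_iff_iff, Equiv.subtypeEquiv_apply]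
    conv_rhs => rw [← τ.forall_congr_right]
    simp

theorem matchingCount_update_eq {y : Fin n → Fin N} {b c : Fin n} (h : y b = y c) (j : Fin N) :
    matchingCount (Function.update y c j) = matchingCount (Function.update y b j) := by
  rw [← matchingCount_comp (Equiv.swap b c) (Function.update y b j)]
  congr 1
  funext d
  by_cases hb : d = b
  · subst hb
    by_cases hc : d = c
    · subst hc; rw [Equiv.swap_self, Equiv.refl_apply]
    · simp [Function.update_of_ne hc, Function.update_of_ne (Ne.symm hc), h]
  · by_cases hc : d = c
    · subst hc; simp
    · rw [Equiv.swap_apply_of_ne_of_ne hb hc, Function.update_of_ne hb, Function.update_of_ne hc]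

theorem particleNumber_eq_sum (i : Fin N) (x : Fin n → Fin N) :
    (particleNumber i x : ℝ) = ∑ a, if x a = i then 1 else 0 := by
  rw [particleNumber, Finset.card_filter]
  push_cast
  rfl

theorem particleNumber_update {i j : Fin N} (hij : i ≠ j) {a : Fin n} {x : Fin n → Fin N}
    (ha : x a = i) : (particleNumber i (Function.update x a j) : ℝ) = particleNumber i x - 1 ∧
      (particleNumber j (Function.update x a j) : ℝ) = particleNumber j x + 1 := by
  simp only [particleNumber_eq_sum]
  constructor
  · rw [← Finset.add_sum_erase _ _ (Finset.mem_univ a),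
      ← Finset.add_sum_erase _ (fun c => if x c = i then (1 : ℝ) else 0) (Finset.mem_univ a)]
    simp only [Function.update_self, if_neg hij.symm, ha, if_true, zero_add, add_sub_cancel_left]
    refine Finset.sum_congr rfl fun c hc => ?_
    rw [Function.update_of_ne (Finset.ne_of_mem_erase hc)]
  · rw [← Finset.add_sum_erase _ _ (Finset.mem_univ a),
      ← Finset.add_sum_erase _ (fun c => if x c = j then (1 : ℝ) else 0) (Finset.mem_univ a)]
    simp only [Function.update_self, ha, if_true, if_neg hij, zero_add]
    rw [add_comm]
    congr 1
    refine Finset.sum_congr rfl fun c hc => ?_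
    rw [Function.update_of_ne (Finset.ne_of_mem_erase hc)]

theorem rawJump_eq_setPair {i : Fin N} (j : Fin N) {a b : Fin n} {x : Fin n → Fin N}
    (ha : x a = i) (hb : x b = i) : rawJump i j a b x = setPair a b x j := by
  funext c
  simp [rawJump, setPair_apply, ha, hb]

theorem rawJump_of_not {i : Fin N} (j : Fin N) {a b : Fin n} {x : Fin n → Fin N}
    (h : ¬ (x a = i ∧ x b = i)) : rawJump i j a b x = x := by
  funext c
  simp [rawJump, h]

theorem rawSwap_of_not {i j : Fin N} {a b : Fin n} {x : Fin n → Fin N}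
    (h : ¬ (x a = i ∧ x b = j)) : rawSwap i j a b x = x := by
  funext c
  simp [rawSwap, h]

theorem rawSwap_eq_comp {i j : Fin N} {a b : Fin n} {x : Fin n → Fin N}
    (ha : x a = i) (hb : x b = j) : rawSwap i j a b x = fun c => x (Equiv.swap a b c) := by
  funext c
  by_cases hca : c = a
  · subst hca
    simp [rawSwap, ha, hb]
  · by_cases hcb : c = b
    · subst hcb
      simp [rawSwap, ha, hb, hca]
    · simp [rawSwap, hca, hcb, Equiv.swap_apply_of_ne_of_ne hca hcb]

theorem rawSwap_eq_update {i j : Fin N} {a b : Fin n} (hab : a ≠ b) {x : Fin n → Fin N}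
    (ha : x a = i) (hb : x b = j) :
    rawSwap i j a b x = Function.update (Function.update x a j) b i := by
  funext c
  by_cases hca : c = a
  · subst hca
    simp [rawSwap, ha, hb, hab]
  · by_cases hcb : c = b
    · subst hcb
      simp [rawSwap, ha, hb, hca]
    · simp [rawSwap, hca, hcb]

/-- This is the invariance of the weight at the intermediate configuration with only `a` moved,
which has `n_i - 1` labels at `i` and `n_j + 1` at `j`. By symmetry under relabelling, all terms of
the same type are equal. -/
theorem matchingCount_rawJump {i j : Fin N} (hij : i ≠ j) {a b : Fin n} (hab : a ≠ b)
    {x : Fin n → Fin N} (ha : x a = i) (hb : x b = i) :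
    ((particleNumber i x : ℝ) - 1) * matchingCount (rawJump i j a b x) =
      ((particleNumber j x : ℝ) + 1) * matchingCount x := by
  set y := Function.update x a j with hy
  have h := isInvariant_matchingCount i j y
  have hyb : y b = i := by rw [hy, Function.update_of_ne hab.symm, hb]
  have hya : y a = j := by simp [hy]
  obtain ⟨h1, h2⟩ := particleNumber_update hij ha
  rw [rawJump_eq_setPair j ha hb, ← h1, ← h2, particleNumber_eq_sum, particleNumber_eq_sum,
    Finset.sum_mul, Finset.sum_mul, ← sub_eq_zero, ← Finset.sum_sub_distrib]
  refine Eq.trans (Finset.sum_congr rfl fun c _ => ?_) h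
  rw [← hy]
  congr 1
  · by_cases hc : y c = i
    · rw [if_pos hc, if_pos hc, one_mul, matchingCount_update_eq (hyb.trans hc.symm)]
      rfl
    · simp [hc]
  · by_cases hc : y c = j
    · rw [if_pos hc, if_pos hc, one_mul, matchingCount_update_eq (hya.trans hc.symm), hy, ← ha]
      simp
    · simp [hc]

/-! ### The square of a rotation as a sum over jumps and swaps -/

theorem sum_labelPair (F : Fin n → Fin n → ℝ) :
    ∑ p : LabelPair n, F p.1.1 p.1.2 = ∑ a, ∑ b, if b ≠ a then F a b else 0 := by
  rw [← Finset.sum_product', ← Finset.sum_filter]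
  symm
  refine Finset.sum_subtype _ (fun p => ?_) fun p : Fin n × Fin n => F p.1 p.2
  simp [ne_comm]

theorem sum_labelPair_same (i : Fin N) (x : Fin n → Fin N) :
    ∑ p : LabelPair n, (if x p.1.1 = i ∧ x p.1.2 = i then (1 : ℝ) else 0) =
      (particleNumber i x : ℝ) * (particleNumber i x - 1) := by
  rw [sum_labelPair fun a b => if x a = i ∧ x b = i then (1 : ℝ) else 0, particleNumber_eq_sum,
    Finset.sum_mul]
  refine Finset.sum_congr rfl fun a _ => ?_
  by_cases ha : x a = i
  · rw [← Finset.add_sum_erase _ _ (Finset.mem_univ a),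
      ← Finset.add_sum_erase _ (fun c => if x c = i then (1 : ℝ) else 0) (Finset.mem_univ a)]
    simp only [ha, ne_eq, not_true_eq_false, if_false, zero_add, if_true, true_and, one_mul,
      add_sub_cancel_left]
    refine Finset.sum_congr rfl fun c hc => ?_
    rw [if_pos (Finset.ne_of_mem_erase hc)]
  · simp [ha]

theorem sum_labelPair_distinct {i j : Fin N} (hij : i ≠ j) (x : Fin n → Fin N) :
    ∑ p : LabelPair n, (if x p.1.1 = i ∧ x p.1.2 = j then (1 : ℝ) else 0) =
      (particleNumber i x : ℝ) * particleNumber j x := by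
  rw [sum_labelPair fun a b => if x a = i ∧ x b = j then (1 : ℝ) else 0, particleNumber_eq_sum,
    particleNumber_eq_sum, Finset.sum_mul_sum]
  refine Finset.sum_congr rfl fun a _ => Finset.sum_congr rfl fun b _ => ?_
  by_cases hb : b = a
  · subst hb
    by_cases h1 : x b = i
    · have h2 : x b ≠ j := fun h => hij (h1.symm.trans h)
      simp [h2]
    · simp [h1]
  · rw [if_pos hb]
    by_cases h1 : x a = i <;> by_cases h2 : x b = j <;> simp [h1, h2]

/-- One half of the square of a rotation. -/
theorem sum_rotation_update {i j : Fin N} (hij : i ≠ j) (g : (Fin n → Fin N) → ℝ)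
    (x : Fin n → Fin N) :
    ∑ a, (if x a = i then rotation i j g (Function.update x a j) else 0) =
      ∑ p : LabelPair n, ((if x p.1.1 = i ∧ x p.1.2 = i then g (rawJump i j p.1.1 p.1.2 x) else 0) -
        (if x p.1.1 = i ∧ x p.1.2 = j then g (rawSwap i j p.1.1 p.1.2 x) else 0)) -
      particleNumber i x * g x := by
  rw [sum_labelPair fun a b => ((if x a = i ∧ x b = i then g (rawJump i j a b x) else 0) -
        (if x a = i ∧ x b = j then g (rawSwap i j a b x) else 0)), particleNumber_eq_sum,
    Finset.sum_mul, ← Finset.sum_sub_distrib]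
  refine Finset.sum_congr rfl fun a _ => ?_
  by_cases ha : x a = i
  · rw [if_pos ha, if_pos ha, rotation, ← Finset.add_sum_erase _ _ (Finset.mem_univ a),
      ← Finset.add_sum_erase _ (fun b => if b ≠ a then _ else (0 : ℝ)) (Finset.mem_univ a)]
    -- Moving the same label there and back gives the diagonal term `-n_i * g x`.
    have hx : Function.update (Function.update x a j) a i = x := by
      rw [Function.update_idem, ← ha, Function.update_eq_self]
    simp only [Function.update_self, hij.symm, if_false, if_true, hx, ne_eq, not_true_eq_false,
      zero_add, zero_sub, one_mul]
    rw [add_comm, ← sub_eq_add_neg]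
    congr 1
    refine Finset.sum_congr rfl fun b hb => ?_
    have hb' := Finset.ne_of_mem_erase hb
    rw [if_pos hb', Function.update_of_ne hb']
    congr 1
    · by_cases h : x b = i
      · rw [if_pos h, if_pos ⟨ha, h⟩, rawJump_eq_setPair j ha h]
        rfl
      · rw [if_neg h, if_neg fun h' => h h'.2]
    · by_cases h : x b = j
      · rw [if_pos h, if_pos ⟨ha, h⟩, rawSwap_eq_update hb'.symm ha h]
      · rw [if_neg h, if_neg fun h' => h h'.2]
  · simp [ha]

theorem sum_rawSwap_comm (i j : Fin N) (g : (Fin n → Fin N) → ℝ) (x : Fin n → Fin N) :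
    ∑ p : LabelPair n, (if x p.1.1 = j ∧ x p.1.2 = i then g (rawSwap j i p.1.1 p.1.2 x) else 0) =
      ∑ p : LabelPair n,
        (if x p.1.1 = i ∧ x p.1.2 = j then g (rawSwap i j p.1.1 p.1.2 x) else 0) := by
  refine Fintype.sum_equiv (Equiv.subtypeEquiv (Equiv.prodComm _ _) fun p => ?_) _ _ fun p => ?_
  · exact ne_comm
  · change _ = if x p.1.2 = i ∧ x p.1.1 = j then g (rawSwap i j p.1.2 p.1.1 x) else 0
    by_cases h : x p.1.1 = j ∧ x p.1.2 = i
    · rw [if_pos h, if_pos h.symm, rawSwap_eq_comp h.1 h.2, rawSwap_eq_comp h.2 h.1,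
        Equiv.swap_comm]
    · rw [if_neg h, if_neg fun h' => h h'.symm]

theorem rotation_rotation {i j : Fin N} (hij : i ≠ j) (g : (Fin n → Fin N) → ℝ)
    (x : Fin n → Fin N) :
    rotation i j (rotation i j g) x =
      ∑ p : LabelPair n, (if x p.1.1 = i ∧ x p.1.2 = i then g (rawJump i j p.1.1 p.1.2 x) else 0) +
      ∑ p : LabelPair n, (if x p.1.1 = j ∧ x p.1.2 = j then g (rawJump j i p.1.1 p.1.2 x) else 0) -
      2 * ∑ p : LabelPair n,
        (if x p.1.1 = i ∧ x p.1.2 = j then g (rawSwap i j p.1.1 p.1.2 x) else 0) -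
      (particleNumber i x + particleNumber j x) * g x := by
  have h1 := sum_rotation_update hij g x
  have h2 := sum_rotation_update hij.symm g x
  rw [Finset.sum_sub_distrib] at h1 h2
  rw [sum_rawSwap_comm i j] at h2
  have h3 : rotation i j (rotation i j g) x =
      ∑ a, (if x a = i then rotation i j g (Function.update x a j) else 0) +
      ∑ a, (if x a = j then rotation j i g (Function.update x a i) else 0) := by
    rw [rotation, ← Finset.sum_add_distrib]
    refine Finset.sum_congr rfl fun a _ => ?_
    rw [rotation_swap i j]
    split_ifs <;> ring
  rw [h3, h1, h2]
  ring

/-! ### Conjugating the generators into squared rotations -/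

/-- The tensor associated with a function on even configurations. -/
noncomputable def toTensor (f : EvenConfig n N → ℝ) (x : Fin n → Fin N) : ℝ :=
  Function.extend Subtype.val f 0 x * matchingCount x

theorem toTensor_coe (f : EvenConfig n N → ℝ) (x : EvenConfig n N) :
    toTensor f x.1 = f x * matchingCount x.1 := by
  rw [toTensor, Subtype.val_injective.extend_apply]

theorem toTensor_of_not_isEven (f : EvenConfig n N → ℝ) {x : Fin n → Fin N} (hx : ¬ IsEven x) :
    toTensor f x = 0 := by
  rw [toTensor, Function.extend_apply', Pi.zero_apply, zero_mul]
  rintro ⟨y, rfl⟩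
  exact hx y.2

theorem particleNumber_sub_one_ne_zero (i : Fin N) (x : EvenConfig n N) :
    (particleNumber i x.1 : ℝ) - 1 ≠ 0 := by
  intro h
  have h1 : particleNumber i x.1 = 1 := by exact_mod_cast sub_eq_zero.1 h
  have h2 := x.2 i
  rw [h1] at h2
  exact absurd h2 (by decide)

theorem matchingCount_mul_sum_jump {i j : Fin N} (hij : i ≠ j) (f : EvenConfig n N → ℝ)
    (x : EvenConfig n N) :
    matchingCount x.1 * (((particleNumber j x.1 : ℝ) + 1) / ((particleNumber i x.1 : ℝ) - 1) *
      ∑ p : LabelPair n, (f (jump i j p x) - f x)) =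
    ∑ p : LabelPair n, (if x.1 p.1.1 = i ∧ x.1 p.1.2 = i then
        toTensor f (rawJump i j p.1.1 p.1.2 x.1) else 0) -
      particleNumber i x.1 * (particleNumber j x.1 + 1) * toTensor f x.1 := by
  have hne := particleNumber_sub_one_ne_zero i x
  have h1 : (particleNumber i x.1 : ℝ) * (particleNumber j x.1 + 1) * toTensor f x.1 =
      ∑ p : LabelPair n, (if x.1 p.1.1 = i ∧ x.1 p.1.2 = i then (1 : ℝ) else 0) *
        (((particleNumber j x.1 : ℝ) + 1) / ((particleNumber i x.1 : ℝ) - 1) *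
          toTensor f x.1) := by
    rw [← Finset.sum_mul, sum_labelPair_same]
    field_simp
  rw [h1, ← Finset.sum_sub_distrib, Finset.mul_sum, Finset.mul_sum]
  refine Finset.sum_congr rfl fun p _ => ?_
  by_cases h : x.1 p.1.1 = i ∧ x.1 p.1.2 = i
  · rw [if_pos h, if_pos h]
    have h2 := matchingCount_rawJump hij p.2 h.1 h.2
    have h3 : toTensor f (rawJump i j p.1.1 p.1.2 x.1) =
        f (jump i j p x) * matchingCount (rawJump i j p.1.1 p.1.2 x.1) :=
      toTensor_coe f (jump i j p x)
    rw [h3, toTensor_coe]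
    field_simp
    linear_combination -f (jump i j p x) * h2
  · rw [if_neg h, if_neg h]
    have h2 : jump i j p x = x := Subtype.ext (rawJump_of_not j h)
    rw [h2]
    ring

/-- An effective swap is a relabelling, so it leaves the weight unchanged. -/
theorem matchingCount_mul_sum_swap {i j : Fin N} (hij : i ≠ j) (f : EvenConfig n N → ℝ)
    (x : EvenConfig n N) :
    matchingCount x.1 * ∑ p : LabelPair n, (f (swap i j p x) - f x) =
    ∑ p : LabelPair n, (if x.1 p.1.1 = i ∧ x.1 p.1.2 = j then
        toTensor f (rawSwap i j p.1.1 p.1.2 x.1) else 0) -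
      particleNumber i x.1 * particleNumber j x.1 * toTensor f x.1 := by
  rw [← sum_labelPair_distinct hij, Finset.sum_mul, ← Finset.sum_sub_distrib, Finset.mul_sum]
  refine Finset.sum_congr rfl fun p _ => ?_
  by_cases h : x.1 p.1.1 = i ∧ x.1 p.1.2 = j
  · rw [if_pos h, if_pos h]
    have h3 : toTensor f (rawSwap i j p.1.1 p.1.2 x.1) =
        f (swap i j p x) * matchingCount (rawSwap i j p.1.1 p.1.2 x.1) :=
      toTensor_coe f (swap i j p x)
    rw [h3, toTensor_coe, rawSwap_eq_comp h.1 h.2, matchingCount_comp]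
    ring
  · rw [if_neg h, if_neg h]
    have h2 : swap i j p x = x := Subtype.ext (rawSwap_of_not h)
    rw [h2]
    ring

/-- In terms of tensors the two-site generator is the square of an infinitesimal rotation. -/
theorem matchingCount_mul_twoSiteGenerator {i j : Fin N} (hij : i ≠ j) (f : EvenConfig n N → ℝ)
    (x : EvenConfig n N) :
    matchingCount x.1 * twoSiteGenerator i j f x =
      rotation i j (rotation i j (toTensor f)) x.1 := by
  have h1 := matchingCount_mul_sum_jump hij f x
  have h2 := matchingCount_mul_sum_jump hij.symm f x
  have h3 := matchingCount_mul_sum_swap hij f x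
  have h4 : twoSiteGenerator i j f x = moveOp i j f x - exchangeOp i j f x := rfl
  rw [rotation_rotation hij, h4, moveOp, exchangeOp]
  -- The diagonal terms agree since `n_i (n_j + 1) + n_j (n_i + 1) - 2 n_i n_j = n_i + n_j`.
  linear_combination h1 + h2 - 2 * h3

theorem isEven_of_matchingTensor_ne_zero {σ : Equiv.Perm (Fin n)} (hσ : IsMatching σ)
    {x : Fin n → Fin N} (h : matchingTensor σ x ≠ 0) : IsEven x := by
  intro i
  by_contra hi
  exact h (isEvenTensor_matchingTensor hσ i x hi)

/-- Every even configuration is stabilized by some perfect matching. -/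
theorem exists_matching_of_isEven {x : Fin n → Fin N} (hx : IsEven x) :
    ∃ σ : Equiv.Perm (Fin n), IsMatching σ ∧ (fun a => x (σ a)) = x := by
  -- Each fibre is split into pairs, and the matching flips the Boolean coordinate.
  have h : ∀ i, ∃ k, Nonempty ({a // x a = i} ≃ Fin k × Bool) := by
    intro i
    obtain ⟨k, hk⟩ := hx i
    refine ⟨k, ⟨Fintype.equivOfCardEq ?_⟩⟩
    rw [Fintype.card_subtype, Fintype.card_prod, Fintype.card_fin, Fintype.card_bool, mul_two]
    exact hk
  choose k hk using h
  have e := fun i => (hk i).some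
  let s : ∀ i, Equiv.Perm {a // x a = i} := fun i =>
    (e i).symm.permCongr (Equiv.prodCongr (Equiv.refl _) Equiv.boolNot)
  have hs : ∀ i a, s i (s i a) = a ∧ s i a ≠ a := by
    intro i a
    obtain ⟨⟨p, q⟩, rfl⟩ := (e i).symm.surjective a
    simp [s]
  let σ : Equiv.Perm (Fin n) := (Equiv.sigmaFiberEquiv x).permCongr (Equiv.sigmaCongrRight s)
  have hσ : ∀ a, σ a = (s (x a) ⟨a, rfl⟩ : {b // x b = x a}) := fun a => rfl
  have hx' : ∀ a, x (σ a) = x a := fun a => by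
    rw [hσ]; exact (s (x a) ⟨a, rfl⟩).2
  refine ⟨σ, fun a => ⟨?_, fun h => ?_⟩, funext hx'⟩
  · obtain ⟨p, rfl⟩ := (Equiv.sigmaFiberEquiv x).surjective a
    simp only [σ, Equiv.permCongr_apply, Equiv.symm_apply_apply, Equiv.sigmaCongrRight_apply,
      (hs _ _).1]
  · rw [hσ] at h
    exact (hs (x a) ⟨a, rfl⟩).2 (Subtype.ext h)

theorem matchingCount_pos (x : EvenConfig n N) : 0 < matchingCount x.1 := by
  obtain ⟨σ, hσ, h⟩ := exists_matching_of_isEven x.2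
  refine Finset.sum_pos' (fun τ _ => matchingTensor_nonneg τ.1 x.1)
    ⟨⟨σ, hσ⟩, Finset.mem_univ _, ?_⟩
  simp [matchingTensor, h]

theorem stratumIndicator_apply (σ : PerfectMatching n) (x : EvenConfig n N) :
    stratumIndicator σ x = matchingTensor σ.1 x.1 / matchingCount x.1 := by
  have h : ∀ τ : PerfectMatching n,
      (if relabel τ.1 x = x then (1 : ℝ) else 0) = matchingTensor τ.1 x.1 := fun τ => by
    unfold matchingTensor
    simp only [Subtype.ext_iff, relabel]
  simp only [stratumIndicator, h, matchingCount]

theorem toTensor_stratumIndicator (σ : PerfectMatching n) :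
    toTensor (stratumIndicator σ : EvenConfig n N → ℝ) = matchingTensor σ.1 := by
  funext x
  by_cases hx : IsEven x
  · have h := toTensor_coe (stratumIndicator σ) ⟨x, hx⟩
    rw [stratumIndicator_apply, div_mul_cancel₀ _ (matchingCount_pos ⟨x, hx⟩).ne'] at h
    exact h
  · rw [toTensor_of_not_isEven _ hx]
    by_contra h
    exact hx (isEven_of_matchingTensor_ne_zero σ.2 (Ne.symm h))

theorem mem_globalKernel_iff {f : EvenConfig n N → ℝ} :
    f ∈ globalKernel n N ↔ ∀ i j : Fin N, i < j → twoSiteGenerator i j f = 0 := by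
  simp [globalKernel, Submodule.mem_iInf]

theorem isInvariant_toTensor {f : EvenConfig n N → ℝ} (hf : f ∈ globalKernel n N) :
    IsInvariant (toTensor f) := by
  have hlt : ∀ i j : Fin N, i < j → ∀ x, rotation i j (toTensor f) x = 0 := by
    intro i j hij
    refine rotation_eq_zero_of_sq i j _ fun x => ?_
    by_cases hx : IsEven x
    · have h := matchingCount_mul_twoSiteGenerator hij.ne f ⟨x, hx⟩
      rw [mem_globalKernel_iff.1 hf i j hij, Pi.zero_apply, mul_zero] at h
      rw [← h, mul_zero]
    · rw [toTensor_of_not_isEven _ hx, zero_mul]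
  intro i j x
  rcases lt_trichotomy i j with h | rfl | h
  · exact hlt i j h x
  · exact rotation_self i _ x
  · rw [rotation_swap, hlt j i h, neg_zero]

/-- Restriction to even configurations, divided by the number of stabilizing matchings. -/
noncomputable def ofTensor : ((Fin n → Fin N) → ℝ) →ₗ[ℝ] (EvenConfig n N → ℝ) where
  toFun g x := g x.1 / matchingCount x.1
  map_add' g h := by funext x; simp [add_div]
  map_smul' r g := by funext x; simp [mul_div_assoc]

theorem ofTensor_toTensor (f : EvenConfig n N → ℝ) : ofTensor (toTensor f) = f := by
  funext x
  change toTensor f x.1 / matchingCount x.1 = f x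
  rw [toTensor_coe, mul_div_cancel_right₀ _ (matchingCount_pos x).ne']

theorem globalKernel_eq_span : globalKernel n N =
    Submodule.span ℝ (Set.range fun σ : PerfectMatching n =>
      (stratumIndicator σ : EvenConfig n N → ℝ)) := by
  apply le_antisymm
  · intro f hf
    have h : toTensor f ∈ Submodule.span ℝ (Set.range fun σ : {σ : Equiv.Perm (Fin n) //
        IsMatching σ} => (matchingTensor σ.1 : (Fin n → Fin N) → ℝ)) := by
      refine mem_span_matchingTensor (isInvariant_toTensor hf) fun i x hi => ?_
      exact toTensor_of_not_isEven f fun hx => hi (hx i)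
    have h2 := Submodule.mem_map_of_mem (f := ofTensor) h
    rw [ofTensor_toTensor, Submodule.map_span, ← Set.range_comp] at h2
    refine Submodule.span_mono ?_ h2
    rintro _ ⟨σ, rfl⟩
    refine ⟨⟨σ.1, σ.2⟩, ?_⟩
    funext x
    exact stratumIndicator_apply _ x
  · rw [Submodule.span_le]
    rintro _ ⟨σ, rfl⟩
    refine mem_globalKernel_iff.2 fun i j hij => funext fun x => ?_
    have h := matchingCount_mul_twoSiteGenerator hij.ne (stratumIndicator σ) x
    have h0 : rotation i j (matchingTensor σ.1 : (Fin n → Fin N) → ℝ) = fun _ => 0 :=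
      funext fun x => rotation_matchingTensor σ.2 i j x
    rw [toTensor_stratumIndicator, h0] at h
    have h1 : matchingCount x.1 * twoSiteGenerator i j (stratumIndicator σ) x = 0 := by
      rw [h]; simp [rotation]
    exact (mul_eq_zero.1 h1).resolve_left (matchingCount_pos x).ne'

/-! ### Linear independence -/

/-- If there are enough sites, the pairs of a matching can be placed at distinct sites. -/
theorem exists_separating_config (hn : n ≤ 2 * N) {σ : Equiv.Perm (Fin n)} (hσ : IsMatching σ) :
    ∃ x : Fin n → Fin N, ∀ a b, x a = x b ↔ b = a ∨ b = σ a := by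
  -- The smaller label of each pair represents it, so there are `n / 2 ≤ N` representatives to embed
  -- into the sites.
  let c : Fin n → Fin n := fun a => min a (σ a)
  have hc : ∀ a b, c a = c b ↔ b = a ∨ b = σ a := by
    intro a b
    constructor
    · intro h
      rcases min_choice a (σ a) with h1 | h1 <;> rcases min_choice b (σ b) with h2 | h2 <;>
        simp only [c, h1, h2] at h
      · exact Or.inl h.symm
      · right; rw [h, (hσ b).1]
      · exact Or.inr h.symm
      · exact Or.inl (σ.injective h.symm)
    · rintro (rfl | rfl)
      · rfl
      · simp only [c, (hσ a).1, min_comm]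
  have hcard : n = 2 * (Finset.univ.image c).card := by
    have h := Finset.card_eq_sum_card_image c Finset.univ
    rw [Finset.card_univ, Fintype.card_fin, Finset.sum_const_nat (m := 2)] at h
    · rw [mul_comm]; exact h
    · intro k hk
      obtain ⟨a, -, rfl⟩ := Finset.mem_image.1 hk
      rw [← Finset.card_pair (hσ a).2.symm]
      congr 1
      ext b
      rw [Finset.mem_filter, eq_comm (a := c b), hc]
      simp
  have hle : Fintype.card (Finset.univ.image c) ≤ Fintype.card (Fin N) := by
    rw [Fintype.card_coe, Fintype.card_fin]
    omega
  obtain ⟨e⟩ := Function.Embedding.nonempty_of_card_le hle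
  refine ⟨fun a => e ⟨c a, Finset.mem_image_of_mem c (Finset.mem_univ a)⟩, fun a b => ?_⟩
  rw [e.injective.eq_iff, Subtype.mk.injEq, hc]

theorem linearIndependent_stratumIndicator (hn : n ≤ 2 * N) :
    LinearIndependent ℝ (fun σ : PerfectMatching n =>
      (stratumIndicator σ : EvenConfig n N → ℝ)) := by
  rw [Fintype.linearIndependent_iff]
  intro r hr σ
  obtain ⟨x, hx⟩ := exists_separating_config hn σ.2
  have hself : (fun a => x (σ.1 a)) = x := by
    funext a
    exact ((hx a (σ.1 a)).2 (Or.inr rfl)).symm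
  have hother : ∀ τ : PerfectMatching n, τ ≠ σ → matchingTensor τ.1 x = 0 := by
    intro τ hτ
    refine if_neg fun h => hτ (Subtype.ext (Equiv.ext fun a => ?_))
    exact ((hx a (τ.1 a)).1 (congrFun h a).symm).resolve_left (τ.2 a).2
  have hone : matchingTensor σ.1 x = 1 := if_pos hself
  have heven : IsEven x :=
    isEven_of_matchingTensor_ne_zero σ.2 (by rw [hone]; exact one_ne_zero)
  have h := congrFun hr ⟨x, heven⟩
  simp only [Finset.sum_apply, Pi.smul_apply, smul_eq_mul, stratumIndicator_apply,
    Pi.zero_apply] at h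
  rw [Finset.sum_eq_single σ (fun τ _ hτ => by rw [hother τ hτ]; simp) (by simp), hone] at h
  exact (mul_eq_zero.1 h).resolve_right
    (one_div_ne_zero (matchingCount_pos ⟨x, heven⟩).ne')

/-! ### Counting perfect matchings -/

theorem isMatching_iff_cycleType {σ : Equiv.Perm (Fin n)} {k : ℕ} (hk : n = 2 * k) :
    IsMatching σ ↔ σ.cycleType = Multiset.replicate k 2 := by
  have hsq : σ ^ 2 = 1 ↔ ∀ a, σ (σ a) = a := by
    rw [sq, Equiv.ext_iff]; rfl
  constructor
  · intro h
    have h1 := Equiv.Perm.cycleType_of_pow_prime_eq_one (p := 2) (hsq.2 fun a => (h a).1)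
    have h2 : σ.support = Finset.univ := by
      ext a; simp [(h a).2]
    have h3 := σ.sum_cycleType
    rw [h1, h2, Multiset.sum_replicate, Finset.card_univ, Fintype.card_fin, smul_eq_mul] at h3
    rw [h1]
    congr 1
    omega
  · intro h a
    refine ⟨hsq.1 (Equiv.Perm.pow_prime_eq_one_iff.2 fun c hc => ?_) a, ?_⟩
    · rw [h] at hc
      exact Multiset.eq_of_mem_replicate hc
    · have h3 := σ.sum_cycleType
      have h4 : σ.support = Finset.univ := by
        rw [← Finset.card_eq_iff_eq_univ, ← h3, h, Multiset.sum_replicate, Fintype.card_fin,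
          smul_eq_mul]
        omega
      rw [← Equiv.Perm.mem_support, h4]
      exact Finset.mem_univ a

theorem matchingFactorial_mul (k : ℕ) :
    matchingFactorial (2 * k) * (2 ^ k * k.factorial) = (2 * k).factorial := by
  induction k with
  | zero => rfl
  | succ k ih =>
    rw [show 2 * (k + 1) = 2 * k + 2 by ring, matchingFactorial, Nat.factorial_succ (2 * k + 1),
      Nat.factorial_succ (2 * k), ← ih, Nat.factorial_succ k]
    ring

theorem matchingFactorial_odd (k : ℕ) : matchingFactorial (2 * k + 1) = 0 := by
  induction k with
  | zero => rfl
  | succ k ih =>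
    rw [show 2 * (k + 1) + 1 = 2 * k + 1 + 2 by ring, matchingFactorial, ih, mul_zero]

/-- For `n = 2 * k` the matchings are the permutations of cycle type `2^k`, of which there are
`(2k)! / (2^k k!)`. -/
theorem card_perfectMatching : Fintype.card (PerfectMatching n) = matchingFactorial n := by
  rcases Nat.even_or_odd' n with ⟨k, hk | hk⟩
  · have h := Equiv.Perm.card_of_cycleType_mul_eq (Fin n) (Multiset.replicate k 2)
    have h2 : Fintype.card (PerfectMatching n) =
        (Finset.univ.filter fun σ : Equiv.Perm (Fin n) =>
          σ.cycleType = Multiset.replicate k 2).card := by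
      rw [Fintype.card_subtype]
      congr 1
      ext σ
      simp only [Finset.mem_filter, Finset.mem_univ, true_and]
      exact isMatching_iff_cycleType hk
    have h3 : ∏ m ∈ (Multiset.replicate k 2).toFinset, ((Multiset.replicate k 2).count m).factorial
        = k.factorial := by
      rcases Nat.eq_zero_or_pos k with rfl | hk0
      · simp
      · rw [Multiset.toFinset_replicate, if_neg hk0.ne', Finset.prod_singleton,
          Multiset.count_replicate_self]
    rw [← h2, h3, if_pos ⟨by simp [hk, mul_comm], fun a ha =>
      (Multiset.eq_of_mem_replicate ha).ge⟩, Multiset.prod_replicate, Multiset.sum_replicate,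
      Fintype.card_fin, smul_eq_mul, hk, mul_comm k 2, Nat.sub_self, Nat.factorial_zero, one_mul,
      ← matchingFactorial_mul] at h
    subst hk
    exact Nat.eq_of_mul_eq_mul_right (by positivity) h
  · rw [hk, matchingFactorial_odd, Fintype.card_eq_zero_iff]
    refine ⟨fun σ => ?_⟩
    -- A matching stabilizes the configuration with every label at one site, so that configuration
    -- would be even, contradicting odd `n`.
    have h1 : (fun a => (fun _ => 0 : Fin (2 * k + 1) → Fin 1) (σ.1 a)) = fun _ => 0 := rfl
    have h2 : IsEven (fun _ => 0 : Fin (2 * k + 1) → Fin 1) :=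
      isEven_of_matchingTensor_ne_zero (σ := σ.1) σ.2 (by rw [matchingTensor, if_pos h1]; simp)
    have h3 := h2 0
    simp [particleNumber] at h3

end ColoredFlow

theorem corollary6p10 (n N : ℕ) :
    ColoredFlow.globalKernel n N =
        Submodule.span ℝ (Set.range fun σ : ColoredFlow.PerfectMatching n =>
          (ColoredFlow.stratumIndicator σ : ColoredFlow.EvenConfig n N → ℝ)) ∧
      (n ≤ 2 * N →
        LinearIndependent ℝ (fun σ : ColoredFlow.PerfectMatching n =>
          (ColoredFlow.stratumIndicator σ : ColoredFlow.EvenConfig n N → ℝ)) ∧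
        Module.finrank ℝ (ColoredFlow.globalKernel n N) = ColoredFlow.matchingFactorial n) := by
  refine ⟨ColoredFlow.globalKernel_eq_span, fun hn => ?_⟩
  have h := ColoredFlow.linearIndependent_stratumIndicator hn
  refine ⟨h, ?_⟩
  rw [ColoredFlow.globalKernel_eq_span, finrank_span_eq_card h, ColoredFlow.card_perfectMatching]
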